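/- Let $p$ be an odd prime, let $n\ge 1$, and let $L/K$ be a separable field extension of degree $2p^n$ with Galois (normal) closure $\widetilde L$. A Hopf Galois structure on $L/K$ is a pair $(H,\mu)$, where $H$ is a finite-dimensional cocommutative $K$-Hopf algebra and $\mu:H\to\mathrm{End}_K(L)$ is a $K$-linear map that makes $L$ a left $H$-module algebra and for which the induced $K$-linear map $L\otimes_K H\to \mathrm{End}_K(L)$, $\ell\otimes h\mapsto (x\mapsto \ell\,\mu(h)(x))$, is bijective. It is of type $N$, for a group $N$, if $\widetilde L\otimes_K H\cong \widetilde L[N]$ as $\widetilde L$-Hopf algebras. (Equivalently, $N$ is isomorphic to the regular subgroup of $\mathrm{Sym}(G/G')$, with $G=\mathrm{Gal}(\widetilde L/K)$ and $G'=\mathrm{Gal}(\widetilde L/L)$, that corresponds to $(H,\mu)$ under the Greither--Pareigis correspondence.) If $L/K$ has a Hopf Galois structure whose type is the dihedral group $D_{2p^n}$ of order $2p^n$, then $L/K$ has no Hopf Galois structure of type $N$ for any group $N$ of order $2p^n$ and exponent $<2p^n$. -/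

import Mathlib

open scoped TensorProduct

universe u v w w₁ w₂

/-- A Hopf Galois structure on a field extension `L/K`: a finite cocommutative `K`-Hopf algebra `H`
together with a Hopf action `μ` of `H` on `L`, i.e. a `K`-linear map `μ : H → End_K(L)` which makes
`L` a left `H`-module algebra and for which the induced `K`-linear map
`L ⊗[K] H → End_K(L)`, `l ⊗ h ↦ (x ↦ l * μ h x)`, is bijective. -/
structure HopfGaloisStructure (K : Type u) (L : Type v) [Field K] [Field L] [Algebra K L] where
  /-- The underlying Hopf algebra. -/
  H : Type w
  [ring : Ring H]
  [hopfAlgebra : HopfAlgebra K H]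
  [finite : Module.Finite K H]
  [isCocomm : Coalgebra.IsCocomm K H]
  /-- The action, a left `H`-module structure on `L` over `K`. -/
  μ : H →ₐ[K] Module.End K L
  /-- `h · 1 = ε(h) 1`. -/
  map_one' : ∀ h : H, μ h 1 = algebraMap K L (Coalgebra.counit h)
  /-- `h · (x y) = ∑ (h₁ · x) (h₂ · y)`, where `Δ h = ∑ h₁ ⊗ h₂`. -/
  map_mul' : ∀ (h : H) (x y : L),
    μ h (x * y) = LinearMap.mul' K L
      (TensorProduct.map (μ.toLinearMap.flip x) (μ.toLinearMap.flip y) (Coalgebra.comul h))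
  /-- The induced map `l ⊗ h ↦ (x ↦ l * μ h x)` is an isomorphism. -/
  bijective' : Function.Bijective
    (TensorProduct.lift
      ((LinearMap.mul K (Module.End K L)).compl₁₂ (LinearMap.mul K L) μ.toLinearMap) :
      L ⊗[K] H →ₗ[K] Module.End K L)

namespace HopfGaloisStructure

attribute [instance] ring hopfAlgebra finite isCocomm

/-- Let `E` be a Galois closure of the separable extension `L/K`. The Hopf Galois structure `S` with
Hopf algebra `H` is of type `N` if `E ⊗[K] H` and the group algebra `E[N]` are isomorphic as
`E`-Hopf algebras (an isomorphism of bialgebras automatically respects the antipodes).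

The Hopf algebra attached to a regular subgroup `N` of `Sym(G/G')` normalized by `G = Gal(E/K)` is
the form `E[N]^G` of `E[N]`, so that `E ⊗[K] E[N]^G ≅ E[N]`; conversely `N` is recovered, up to
isomorphism, as the group of group-like elements of `E ⊗[K] H`. -/
def IsOfType {K : Type u} {L : Type v} [Field K] [Field L] [Algebra K L]
    (S : HopfGaloisStructure.{u, v, w} K L)
    (E : Type*) [Field E] [Algebra K E] (N : Type*) [Group N] : Prop :=
  Nonempty ((E ⊗[K] S.H) ≃ₐc[E] MonoidAlgebra E N)

end HopfGaloisStructure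

/-! Let `G = Gal(E/K)`. A Hopf Galois structure of type `N` makes the group-like elements `N` of `E
⊗ H` act simply transitively on the embeddings `L → E`, and `G` acts on these too. Writing `g ∘ x₀ =
x₀ · c g` gives a surjective crossed homomorphism `c : G → N` whose fibres depend only on `L/K`
(`IsOfType.exists_crossedHom`). So types `D` (dihedral) and `N` yield `c`, `c'` with the same
fibres.

Both groups have a characteristic Sylow `p`-subgroup of index 2, `R` and `P`, and a Sylow
`p`-subgroup `J` of `G` maps onto each (`crossedHom_image_sylow`). Since `R = ⟨r⟩`, take `g ∈ J`
with `c g = r`. Then `c (g ^ k) = r ^ (1 + a + ⋯ + a ^ (k - 1))` with `a ≡ 1` mod `p`, and lifting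
the exponent shows that these values exhaust `R`. By equality of fibres the `c' (g ^ k)` exhaust
`P`: an affine map of `P` with linear part of `p`-power order is transitive. For odd `p` this forces
`P` to be cyclic (`isCyclic_of_iterate_affine_surjective`), so `N` has elements of orders `p ^ n`
and 2, hence exponent `2 * p ^ n`. -/

/-! ### Transitive affine maps on `p`-groups, `p` odd -/

/-- If `a = k • c + p • b` is solvable for every `a`, then `c` generates a group killed by a power
of `p`. -/
theorem exists_nsmul_eq_of_forall_exists_add_nsmul {A : Type*} [AddCommGroup A] {p n : ℕ} {c : A}
    (hA : ∀ a : A, p ^ n • a = 0) (h : ∀ a : A, ∃ (k : ℕ) (b : A), a = k • c + p • b) (a : A) :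
    ∃ k : ℕ, a = k • c := by
  have key : ∀ j : ℕ, ∀ a : A, ∃ (k : ℕ) (b : A), a = k • c + p ^ j • b := by
    intro j
    induction j with
    | zero => exact fun a => ⟨0, a, by simp⟩
    | succ j ih =>
      intro a
      obtain ⟨k, b, hb⟩ := ih a
      obtain ⟨k', b', hb'⟩ := h b
      refine ⟨k + p ^ j * k', b', ?_⟩
      rw [hb, hb', smul_add, ← add_assoc, add_smul, mul_smul, pow_succ, mul_smul]
  obtain ⟨k, b, hb⟩ := key n a
  exact ⟨k, by rw [hb, hA, add_zero]⟩

section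

variable {R : Type*} [Ring R]

theorem exists_one_add_pow_eq (T : R) (i : ℕ) :
    ∃ q : R, (1 + T) ^ i = 1 + (i : R) * T + T * T * q := by
  induction i with
  | zero => exact ⟨0, by simp⟩
  | succ i ih =>
    obtain ⟨q, hq⟩ := ih
    refine ⟨(i : R) + q * (1 + T), ?_⟩
    have : T * T * (i : R) = i * T * T := by
      rw [mul_assoc (i : R), ← ((Nat.cast_commute i (T * T)).eq)]
    rw [pow_succ, hq, mul_add (T * T), this]
    push_cast
    noncomm_ring

theorem exists_geom_sum_one_add_eq (T : R) (k : ℕ) :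
    ∃ q : R, ∑ i ∈ Finset.range k, (1 + T) ^ i =
      (k : R) + ((∑ i ∈ Finset.range k, i : ℕ) : R) * T + T * T * q := by
  choose q hq using exists_one_add_pow_eq T
  refine ⟨∑ i ∈ Finset.range k, q i, ?_⟩
  rw [Finset.sum_congr rfl fun i _ => hq i, Finset.sum_add_distrib, Finset.sum_add_distrib,
    ← Finset.mul_sum, ← Finset.sum_mul]
  simp

/-- The coefficient of `T` is `p(p-1)/2`, a multiple of `p` because `p` is odd. This is where the
affine argument needs oddness. -/
theorem exists_geom_sum_prime_one_add_eq (T : R) {p : ℕ} (hodd : Odd p) :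
    ∃ q r : R, ∑ i ∈ Finset.range p, (1 + T) ^ i = (p : R) * r + T * T * q := by
  obtain ⟨q, hq⟩ := exists_geom_sum_one_add_eq T p
  obtain ⟨m, rfl⟩ := hodd
  have : ∑ i ∈ Finset.range (2 * m + 1), i = (2 * m + 1) * m := by
    rw [Finset.sum_range_id, Nat.add_sub_cancel, mul_comm 2 m, ← mul_assoc,
      Nat.mul_div_cancel _ two_pos]
  refine ⟨q, 1 + (m : R) * T, ?_⟩
  rw [hq, this]
  push_cast
  noncomm_ring

end

/-- With `T = α - 1`, the orbit of `0` under `x ↦ c + α x` is too short modulo `pA + T²A` unless `TA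
⊆ pA`. Then `α` is trivial modulo `p`, the orbit modulo `p` consists of multiples of `c`, and `c`
generates `A`. -/
theorem exists_nsmul_eq_of_surjective_geom_sum {A : Type*} [AddCommGroup A] [Finite A] {p n m : ℕ}
    (hp : p.Prime) (hodd : Odd p) (hA : Nat.card A = p ^ n) (α : AddMonoid.End A)
    (hα : α ^ p ^ m = 1) (c : A)
    (hs : ∀ a : A, ∃ k : ℕ, (∑ i ∈ Finset.range k, α ^ i) c = a) (a : A) :
    ∃ k : ℕ, a = k • c := by
  obtain ⟨T, rfl⟩ : ∃ T, α = 1 + T := ⟨α - 1, by abel⟩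
  have hkill : ∀ a : A, p ^ n • a = 0 := fun a => by rw [← hA]; exact card_nsmul_eq_zero'
  have hadd : ∀ (f g : AddMonoid.End A) (a : A), (f + g) a = f a + g a := fun _ _ _ => rfl
  have hmul : ∀ (f g : AddMonoid.End A) (a : A), (f * g) a = f (g a) := fun _ _ _ => rfl
  have hcast : ∀ (k : ℕ) (f : AddMonoid.End A) (a : A), ((k : AddMonoid.End A) * f) a = k • f a :=
    fun k f a => by rw [hmul, AddMonoid.End.natCast_apply]
  -- `T` is nilpotent modulo `p`: expand `(1 + T) ^ p ^ m = 1`.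
  obtain ⟨r, hr⟩ : ∃ r : AddMonoid.End A, T ^ p ^ m = (p : AddMonoid.End A) * r := by
    obtain ⟨r, hr⟩ := (Commute.one_left T).exists_add_pow_prime_pow_eq hp m
    rw [hα, one_pow] at hr
    refine ⟨-(1 * T * r), ?_⟩
    have h1 : T ^ p ^ m + (p : AddMonoid.End A) * 1 * T * r = 0 := by
      have h2 := hr.symm
      rw [add_assoc] at h2
      exact left_eq_add.mp h2.symm
    rw [mul_neg, eq_neg_iff_add_eq_zero, ← h1, mul_assoc, mul_assoc, mul_assoc]
  by_cases htriv : Subsingleton A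
  · exact ⟨0, Subsingleton.elim _ _⟩
  let M : AddSubgroup A := (DistribSMul.toAddMonoidHom A p).range ⊔ (T * T).range
  let M₁ : AddSubgroup A := (DistribSMul.toAddMonoidHom A p).range ⊔ T.range
  have hM : ∀ a, a ∈ M ↔ ∃ b d, a = p • b + T (T d) := fun a => by
    rw [AddSubgroup.mem_sup]
    constructor
    · rintro ⟨_, ⟨b, rfl⟩, _, ⟨d, rfl⟩, rfl⟩
      exact ⟨b, d, rfl⟩
    · rintro ⟨b, d, rfl⟩
      exact ⟨_, ⟨b, rfl⟩, _, ⟨d, rfl⟩, rfl⟩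
  have hM₁ : ∀ a, a ∈ M₁ ↔ ∃ b d, a = p • b + T d := fun a => by
    rw [AddSubgroup.mem_sup]
    constructor
    · rintro ⟨_, ⟨b, rfl⟩, _, ⟨d, rfl⟩, rfl⟩
      exact ⟨b, d, rfl⟩
    · rintro ⟨b, d, rfl⟩
      exact ⟨_, ⟨b, rfl⟩, _, ⟨d, rfl⟩, rfl⟩
  have hle : M ≤ M₁ := fun a ha => by
    obtain ⟨b, d, rfl⟩ := (hM a).mp ha
    exact (hM₁ _).mpr ⟨b, T d, rfl⟩
  -- If `A = pA + TA`, iteration gives `A = pA + T^j A` for all `j`; at `j = p ^ m` this is `A =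
  -- pA`, so `A = 0`.
  have hM₁ne : M₁ ≠ ⊤ := by
    intro htop
    have key : ∀ j : ℕ, ∀ a : A, ∃ b d, a = p • b + (T ^ j) d := by
      intro j
      induction j with
      | zero => exact fun a => ⟨0, a, by simp⟩
      | succ j ih =>
        intro a
        obtain ⟨b, d, rfl⟩ := ih a
        obtain ⟨b', d', rfl⟩ := (hM₁ d).mp (htop ▸ AddSubgroup.mem_top d)
        refine ⟨b + (T ^ j) b', d', ?_⟩
        rw [map_add, map_nsmul, smul_add, pow_succ, hmul, add_assoc]
    refine htriv ⟨fun x y => ?_⟩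
    have : ∀ a : A, a = 0 := fun a => by
      obtain ⟨k, hk⟩ := exists_nsmul_eq_of_forall_exists_add_nsmul (c := (0 : A)) hkill
        (fun a => by
          obtain ⟨b, d, h⟩ := key (p ^ m) a
          exact ⟨0, b + r d, by rw [h, hr, hcast]; simp⟩) a
      simpa using hk
    rw [this x, this y]
  -- The geometric sum of length `p` sends `c` into the `α`-stable subgroup `M`, so the orbit modulo
  -- `M` repeats with period `p`.
  have hindex : M.index ≤ p := by
    obtain ⟨q, r', hq⟩ := exists_geom_sum_prime_one_add_eq T hodd
    have hMα : ∀ (j : ℕ) (a : A), a ∈ M → ((1 + T) ^ j) a ∈ M := by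
      intro j a ha
      obtain ⟨b, d, rfl⟩ := (hM a).mp ha
      refine (hM _).mpr ⟨((1 + T) ^ j) b, ((1 + T) ^ j) d, ?_⟩
      rw [map_add, map_nsmul]
      have : Commute ((1 + T) ^ j) (T * T) :=
        ((Commute.one_left _).add_left ((Commute.refl T).mul_right (Commute.refl T))).pow_left j
      congr 1
      exact DFunLike.congr_fun this.eq d
    have hsp : (∑ i ∈ Finset.range p, (1 + T) ^ i) c ∈ M := by
      rw [hq]
      exact (hM _).mpr ⟨r' c, q c, by rw [hadd, hcast]; rfl⟩
    have hper : ∀ k : ℕ, (QuotientAddGroup.mk ((∑ i ∈ Finset.range k, (1 + T) ^ i) c) : A ⧸ M) =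
        QuotientAddGroup.mk ((∑ i ∈ Finset.range (k % p), (1 + T) ^ i) c) := by
      intro k
      induction k using Nat.strong_induction_on with
      | _ k ih =>
        rcases lt_or_ge k p with hk | hk
        · rw [Nat.mod_eq_of_lt hk]
        · obtain ⟨l, rfl⟩ := Nat.exists_eq_add_of_le' hk
          rw [Nat.add_mod_right, ← ih l (by have := hp.pos; omega), Finset.sum_range_add,
            hadd, QuotientAddGroup.mk_add]
          convert add_zero _
          rw [QuotientAddGroup.eq_zero_iff]
          simp_rw [pow_add]
          rw [← Finset.mul_sum]
          exact hMα l _ hsp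
    rw [AddSubgroup.index]
    have hsurj : Function.Surjective fun k : Fin p =>
        (QuotientAddGroup.mk ((∑ i ∈ Finset.range (k : ℕ), (1 + T) ^ i) c) : A ⧸ M) := by
      intro x
      obtain ⟨a, rfl⟩ := QuotientAddGroup.mk_surjective x
      obtain ⟨k, rfl⟩ := hs a
      exact ⟨⟨k % p, Nat.mod_lt _ hp.pos⟩, (hper k).symm⟩
    simpa using Nat.card_le_card_of_surjective _ hsurj
  -- `M₁` is proper, so its index is at least `p`, while the larger-or-equal index of `M` is at most
  -- `p`.
  have hle' : M₁ ≤ M := by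
    have h1 := AddSubgroup.relIndex_mul_index hle
    have h2 : p ∣ M₁.index := by
      have : M₁.index ∣ p ^ n := hA ▸ M₁.index_dvd_card
      obtain ⟨j, -, hj⟩ := (Nat.dvd_prime_pow hp).mp this
      rcases j with _ | j
      · exact absurd (AddSubgroup.index_eq_one.mp (by simpa using hj)) hM₁ne
      · exact hj ▸ dvd_pow_self p j.succ_ne_zero
    have h3 : M₁.index ≠ 0 := AddSubgroup.index_ne_zero_of_finite
    have h4 := Nat.le_of_dvd (Nat.pos_of_ne_zero h3) h2
    have h5 : M.relIndex M₁ ≠ 0 := by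
      intro h
      rw [h, zero_mul] at h1
      exact AddSubgroup.index_ne_zero_of_finite h1.symm
    rw [← AddSubgroup.relIndex_eq_one]
    nlinarith [Nat.pos_of_ne_zero h3, Nat.pos_of_ne_zero h5]
  have hT : ∀ a : A, ∃ b, T a = p • b := by
    have key : ∀ j : ℕ, ∀ a : A, ∃ b d, T a = p • b + (T ^ j) (T d) := by
      intro j
      induction j with
      | zero => exact fun a => ⟨0, a, by simp⟩
      | succ j ih =>
        intro a
        obtain ⟨b, d, h⟩ := ih a
        obtain ⟨b', d', h'⟩ := (hM _).mp (hle' ((hM₁ (T d)).mpr ⟨0, d, by simp⟩))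
        refine ⟨b + (T ^ j) b', d', ?_⟩
        rw [h, h', map_add, map_nsmul, smul_add, pow_succ, hmul, add_assoc]
    intro a
    obtain ⟨b, d, h⟩ := key (p ^ m) a
    exact ⟨b + r (T d), by rw [h, hr, hcast, smul_add]⟩
  refine exists_nsmul_eq_of_forall_exists_add_nsmul hkill (fun a => ?_) a
  obtain ⟨k, rfl⟩ := hs a
  obtain ⟨q, hq⟩ := exists_geom_sum_one_add_eq T k
  set s := ∑ i ∈ Finset.range k, i
  -- Beyond `k • c`, the geometric sum at `c` is `T` of this element, hence lies in `pA`.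
  obtain ⟨b, hb⟩ := hT (s • c + T (q c))
  refine ⟨k, b, ?_⟩
  rw [← hb, hq, map_add, map_nsmul, hadd, hadd, hcast,
    AddMonoid.End.natCast_apply, add_assoc]
  rfl

theorem CommGroup.isCyclic_of_iterate_affine_surjective {A : Type*} [CommGroup A] [Finite A]
    {p n m : ℕ} (hp : p.Prime) (hodd : Odd p) (hA : Nat.card A = p ^ n) (α : MulAut A)
    (hα : α ^ p ^ m = 1) (c : A) (hs : ∀ a : A, ∃ k : ℕ, (fun x => c * α x)^[k] 1 = a) :
    IsCyclic A := by
  let β : AddMonoid.End (Additive A) := MonoidHom.toAdditive α.toMonoidHom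
  have hβ : ∀ (k : ℕ) (a : A), (β ^ k) (Additive.ofMul a) = Additive.ofMul ((α ^ k) a) := by
    intro k
    induction k with
    | zero => exact fun a => rfl
    | succ k ih =>
      intro a
      rw [pow_succ, pow_succ]
      exact ih (α a)
  have hsum : ∀ k : ℕ, (∑ i ∈ Finset.range k, β ^ i) (Additive.ofMul c) =
      Additive.ofMul ((fun x => c * α x)^[k] 1) := by
    intro k
    induction k with
    | zero => rfl
    | succ k ih =>
      rw [geom_sum_succ, add_comm, Function.iterate_succ_apply', ofMul_mul]
      exact congrArg (fun x => Additive.ofMul c + β x) ih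
  refine ⟨c, fun a => ?_⟩
  obtain ⟨k, hk⟩ := exists_nsmul_eq_of_surjective_geom_sum (A := Additive A) hp hodd hA β
    (by
      ext a
      exact (hβ (p ^ m) a.toMul).trans (by rw [hα]; rfl))
    (Additive.ofMul c)
    (fun a => by
      obtain ⟨k, hk⟩ := hs a.toMul
      exact ⟨k, by rw [hsum, hk]; rfl⟩) (Additive.ofMul a)
  exact ⟨k, by simpa using (congrArg Additive.toMul hk).symm⟩

/-- A finite `p`-group, `p` odd, on which some affine map `x ↦ c * α x` with `α` of `p`-power order
acts transitively is cyclic. -/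
theorem isCyclic_of_iterate_affine_surjective {P : Type*} [Group P] [Finite P] {p n m : ℕ}
    (hp : p.Prime) (hodd : Odd p) (hP : Nat.card P = p ^ n) (α : MulAut P)
    (hα : α ^ p ^ m = 1) (c : P) (hs : ∀ a : P, ∃ k : ℕ, (fun x => c * α x)^[k] 1 = a) :
    IsCyclic P := by
  induction n using Nat.strong_induction_on generalizing P with
  | _ n ih =>
    rcases subsingleton_or_nontrivial P with hsub | hnt
    · infer_instance
    have : Fact p.Prime := ⟨hp⟩
    have hcen : Nontrivial (Subgroup.center P) := (IsPGroup.of_card hP).center_nontrivial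
    have hmap : (Subgroup.center P).map (α : P →* P) = Subgroup.center P :=
      Subgroup.characteristic_iff_map_eq.mp inferInstance α
    have hQ : Nat.card (P ⧸ Subgroup.center P) ∣ p ^ n := hP ▸ Subgroup.card_quotient_dvd_card _
    obtain ⟨l, hl, hlc⟩ := (Nat.dvd_prime_pow hp).mp hQ
    have hlt : l < n := by
      have h1 := (Subgroup.center P).card_eq_card_quotient_mul_card_subgroup
      have h2 : 1 < Nat.card (Subgroup.center P) := Finite.one_lt_card
      refine lt_of_le_of_ne hl ?_
      rintro rfl
      rw [hlc, hP] at h1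
      nlinarith [pow_pos hp.pos l]
    let α' : MulAut (P ⧸ Subgroup.center P) := QuotientGroup.congr _ _ α hmap
    have hα' : ∀ (k : ℕ) (x : P), (α' ^ k) (x : P ⧸ Subgroup.center P) = ((α ^ k) x : P) := by
      intro k
      induction k with
      | zero => exact fun x => rfl
      | succ k ih =>
        intro x
        rw [pow_succ, pow_succ]
        exact ih (α x)
    have hcyc : IsCyclic (P ⧸ Subgroup.center P) := by
      refine ih l hlt hlc α' ?_ c ?_
      · ext x
        obtain ⟨x, rfl⟩ := QuotientGroup.mk_surjective x
        rw [hα', hα]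
        rfl
      · intro x
        obtain ⟨x, rfl⟩ := QuotientGroup.mk_surjective x
        obtain ⟨k, rfl⟩ := hs x
        refine ⟨k, ?_⟩
        have : Function.Semiconj (QuotientGroup.mk : P → P ⧸ Subgroup.center P)
            (fun x => c * α x) (fun x => c * α' x) := fun x => rfl
        exact ((this.iterate_right k) 1).symm
    -- The affine map descends to `P/Z(P)`, cyclic by induction, so `P` is abelian.
    let _ : CommGroup P := commGroupOfCyclicCenterQuotient (QuotientGroup.mk' (Subgroup.center P))
      (by rw [QuotientGroup.ker_mk'])
    exact CommGroup.isCyclic_of_iterate_affine_surjective hp hodd hP α hα c hs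

/-! ### Lifting the exponent -/

/-- `v_p(a^d - 1) = v_p(a - 1) + v_p(d)`, so the geometric sum has the valuation of `d`. The case `a
= 1` is separate, since there `v_p(a - 1)` is infinite. -/
theorem dvd_of_dvd_geom_sum {p n a d : ℕ} (hp : p.Prime) (hodd : Odd p) (ha : a ≡ 1 [MOD p])
    (h : p ^ n ∣ ∑ i ∈ Finset.range d, a ^ i) : p ^ n ∣ d := by
  rcases eq_or_ne a 1 with rfl | ha1
  · simpa using h
  have hdvd : (p : ℤ) ∣ (a : ℤ) - 1 := by
    have := (Nat.modEq_iff_dvd.mp ha.symm)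
    simpa using this
  have hpa : ¬ (p : ℤ) ∣ a := fun h' => by
    have : (p : ℤ) ∣ 1 := by simpa using dvd_sub h' hdvd
    exact (Nat.prime_iff_prime_int.mp hp).not_isUnit (isUnit_of_dvd_one this)
  have key := Int.emultiplicity_pow_sub_pow hp hodd (x := a) (y := 1) hdvd hpa d
  rw [one_pow, ← geom_sum_mul, emultiplicity_mul (Nat.prime_iff_prime_int.mp hp), add_comm] at key
  have hfin : emultiplicity (p : ℤ) ((a : ℤ) - 1) ≠ ⊤ := by
    rw [Ne, emultiplicity_eq_top, not_not]
    refine Int.finiteMultiplicity_iff.mpr ⟨?_, ?_⟩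
    · simpa using hp.ne_one
    · rw [sub_ne_zero]
      exact_mod_cast ha1
  have key2 := WithTop.add_left_cancel hfin key
  rw [pow_dvd_iff_le_emultiplicity, ← key2, ← pow_dvd_iff_le_emultiplicity]
  exact_mod_cast h

/-! ### Crossed homomorphisms and Sylow subgroups -/

section CrossedHom

variable {G D : Type*} [Group G] [Group D] {φ : G →* MulAut D} {c : G → D}

theorem crossedHom_one (hc : ∀ g h, c (g * h) = c g * φ g (c h)) : c 1 = 1 := by
  have := hc 1 1
  simpa using this

theorem crossedHom_pow (hc : ∀ g h, c (g * h) = c g * φ g (c h)) (g : G) (k : ℕ) :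
    c (g ^ k) = (fun x => c g * φ g x)^[k] 1 := by
  induction k with
  | zero => simpa using crossedHom_one hc
  | succ k ih => rw [pow_succ', hc, Function.iterate_succ_apply', ih]

theorem crossedHom_eq_iff (hc : ∀ g h, c (g * h) = c g * φ g (c h)) (g h : G) :
    c g = c h ↔ c (g⁻¹ * h) = 1 := by
  have := hc g (g⁻¹ * h)
  rw [mul_inv_cancel_left] at this
  rw [this]
  simp

/-- As `R` is characteristic of index 2, `c` modulo `R` is an ordinary homomorphism to a group of
order 2. -/
theorem crossedHom_mem_of_index_eq_two (hc : ∀ g h, c (g * h) = c g * φ g (c h))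
    (R : Subgroup D) [R.Characteristic] (hR : R.index = 2) {g : G} {k : ℕ} (hk : Odd k)
    (hg : g ^ k = 1) : c g ∈ R := by
  have hφ : ∀ (g : G) (x : D), φ g x ∈ R ↔ x ∈ R := fun g x => by
    have := Subgroup.characteristic_iff_comap_eq.mp (inferInstance : R.Characteristic) (φ g)
    exact (SetLike.ext_iff.mp this x)
  have hmul : ∀ g h, c (g * h) ∈ R ↔ (c g ∈ R ↔ c h ∈ R) := fun g h => by
    rw [hc, Subgroup.mul_mem_iff_of_index_two hR, hφ]
  obtain ⟨l, rfl⟩ := hk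
  have h1 : c (g ^ (2 * l + 1)) ∈ R := by
    rw [hg, crossedHom_one hc]
    exact R.one_mem
  rw [pow_succ, hmul, two_mul, pow_add, hmul] at h1
  tauto

/-- The fibres of `c` are the left cosets of `S = c⁻¹(1)`, of index `2 * p ^ n`. As `[G : J]` is
prime to `p`, `p ^ n` divides `[J : J ∩ S] = |c(J)|`, while `c(J) ⊆ R`. -/
theorem crossedHom_image_sylow [Finite G] (hc : ∀ g h, c (g * h) = c g * φ g (c h))
    (hsurj : Function.Surjective c) {p n : ℕ} [Fact p.Prime] (hodd : Odd p)
    (hD : Nat.card D = 2 * p ^ n) (R : Subgroup D) [R.Characteristic]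
    (hRc : Nat.card R = p ^ n) (J : Sylow p G) : c '' J = R := by
  have hpn : 0 < p ^ n := pow_pos (Fact.out : p.Prime).pos n
  have : Finite D := Nat.finite_of_card_ne_zero (by omega)
  have hR2 : R.index = 2 := by
    have := R.card_mul_index
    rw [hRc, hD, mul_comm] at this
    exact Nat.eq_of_mul_eq_mul_right hpn this
  have hsub : c '' J ⊆ R := by
    rintro _ ⟨g, hg, rfl⟩
    obtain ⟨k, hk⟩ := J.2 ⟨g, hg⟩
    exact crossedHom_mem_of_index_eq_two hc R hR2 (hodd.pow (n := k))
      (by simpa using congrArg Subtype.val hk)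
  let S : Subgroup G :=
    { carrier := {g | c g = 1}
      one_mem' := crossedHom_one hc
      mul_mem' := fun {a b} ha hb => by
        simp only [Set.mem_ofPred_eq] at *
        rw [hc, ha, hb, map_one, mul_one]
      inv_mem' := fun {a} ha => by
        simp only [Set.mem_ofPred_eq] at *
        have := hc a⁻¹ a
        rw [inv_mul_cancel, crossedHom_one hc, ha, map_one, mul_one] at this
        exact this.symm }
  have hS : ∀ g h, c g = c h ↔ (QuotientGroup.mk g : G ⧸ S) = QuotientGroup.mk h := fun g h => by
    rw [QuotientGroup.eq, crossedHom_eq_iff hc]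
    rfl
  have hSidx : S.index = 2 * p ^ n := by
    rw [← hD]
    refine Nat.card_eq_of_bijective (fun q : G ⧸ S => c q.out) ⟨fun q q' h => ?_, fun d => ?_⟩
    · simpa using (hS _ _).mp h
    · obtain ⟨g, rfl⟩ := hsurj d
      exact ⟨QuotientGroup.mk g, (hS _ _).mpr (by simp)⟩
  have hdvd : p ^ n ∣ S.relIndex J := by
    have h1 := Subgroup.relIndex_mul_index (inf_le_right : S ⊓ (J : Subgroup G) ≤ J)
    have h2 := Subgroup.relIndex_mul_index (inf_le_left : S ⊓ (J : Subgroup G) ≤ S)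
    rw [Subgroup.inf_relIndex_right] at h1
    refine Nat.Coprime.dvd_of_dvd_mul_right (n := (J : Subgroup G).index) ?_ ?_
    · exact Nat.Coprime.pow_left _
        (((Fact.out : p.Prime).coprime_iff_not_dvd).mpr (Sylow.not_dvd_index J))
    · rw [h1, ← h2, hSidx]
      exact ⟨(S ⊓ (J : Subgroup G)).relIndex S * 2, by ring⟩
  refine Set.eq_of_subset_of_ncard_le hsub ?_ (Set.toFinite _)
  rw [← Nat.card_coe_set_eq, ← Nat.card_coe_set_eq]
  refine (hRc.le.trans (Nat.le_of_dvd (Nat.pos_of_ne_zero ?_) hdvd)).trans ?_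
  · exact Subgroup.index_ne_zero_of_finite
  refine Nat.card_le_card_of_injective
    (fun q : J ⧸ S.subgroupOf J => (⟨c q.out, q.out, q.out.2, rfl⟩ : c '' J)) fun q q' h => ?_
  have h1 := (crossedHom_eq_iff hc _ _).mp (congrArg Subtype.val h)
  rw [← QuotientGroup.out_eq' q, ← QuotientGroup.out_eq' q', QuotientGroup.eq,
    Subgroup.mem_subgroupOf]
  exact h1

end CrossedHom

theorem exists_characteristic_subgroup_card_eq {D : Type*} [Group D] {p n : ℕ} [Fact p.Prime]
    (hodd : Odd p) (hD : Nat.card D = 2 * p ^ n) :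
    ∃ R : Subgroup D, R.Characteristic ∧ Nat.card R = p ^ n := by
  have hp : p.Prime := Fact.out
  have : Finite D := Nat.finite_of_card_ne_zero (by have := pow_pos hp.pos n; omega)
  obtain ⟨R⟩ : Nonempty (Sylow p D) := inferInstance
  have hR : Nat.card R = p ^ n := by
    rw [Sylow.card_eq_multiplicity, hD, Nat.factorization_mul (by simp) (pow_ne_zero _ hp.ne_zero)]
    have : p ≠ 2 := by rintro rfl; exact absurd hodd (by decide)
    simp [hp.factorization_self, Nat.factorization_eq_zero_of_not_dvd
      (fun h => this ((Nat.prime_dvd_prime_iff_eq hp Nat.prime_two).mp h))]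
  have hidx : (R : Subgroup D).index = 2 := by
    have := (R : Subgroup D).card_mul_index
    rw [hD, mul_comm] at this
    exact Nat.eq_of_mul_eq_mul_right (pow_pos hp.pos n) (by rw [← this, ← hR])
  have hn : (R : Subgroup D).Normal := Subgroup.normal_of_index_eq_two hidx
  exact ⟨R, Sylow.characteristic_of_normal R hn, hR⟩

/-- If two surjective crossed homomorphisms from a finite group `G` to groups of order `2 * p ^ n`
have the same fibres, and one of these groups has an element of order `p ^ n`, then so does the
other one. -/
theorem exists_orderOf_eq_of_crossedHom {G D N : Type*} [Group G] [Group D] [Group N] [Finite G]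
    {p n : ℕ} (hp : p.Prime) (hodd : Odd p) (hn : 1 ≤ n)
    (hD : Nat.card D = 2 * p ^ n) (hN : Nat.card N = 2 * p ^ n)
    {φ : G →* MulAut D} {ψ : G →* MulAut N} {c : G → D} {c' : G → N}
    (hc : ∀ g h, c (g * h) = c g * φ g (c h)) (hsurj : Function.Surjective c)
    (hc' : ∀ g h, c' (g * h) = c' g * ψ g (c' h)) (hsurj' : Function.Surjective c')
    (hcc : ∀ g h, c g = c h ↔ c' g = c' h) {r : D} (hr : orderOf r = p ^ n) :
    ∃ x : N, orderOf x = p ^ n := by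
  have : Fact p.Prime := ⟨hp⟩
  have hpn : 0 < p ^ n := pow_pos hp.pos n
  have : Finite D := Nat.finite_of_card_ne_zero (by omega)
  have : Finite N := Nat.finite_of_card_ne_zero (by omega)
  obtain ⟨R, hRchar, hRc⟩ := exists_characteristic_subgroup_card_eq hodd hD
  obtain ⟨P, hPchar, hPc⟩ := exists_characteristic_subgroup_card_eq hodd hN
  obtain ⟨J⟩ : Nonempty (Sylow p G) := inferInstance
  have hJR := crossedHom_image_sylow hc hsurj hodd hD R hRc J
  have hJP := crossedHom_image_sylow hc' hsurj' hodd hN P hPc J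
  have hrR : r ∈ R := by
    have hR2 : R.index = 2 := by
      have := R.card_mul_index
      rw [hRc, hD, mul_comm] at this
      exact Nat.eq_of_mul_eq_mul_right hpn this
    -- The identity is a crossed homomorphism for the trivial action.
    have := crossedHom_mem_of_index_eq_two (φ := (1 : D →* MulAut D)) (c := id) (by simp) R hR2
      (hodd.pow (n := n)) (hr ▸ pow_orderOf_eq_one r)
    exact this
  have hzp : Subgroup.zpowers r = R := by
    refine Subgroup.eq_of_le_of_card_ge (by simpa using hrR) ?_
    rw [hRc, Nat.card_zpowers, hr]
  have hmemR : ∀ x ∈ R, ∃ k : ℕ, r ^ k = x := fun x hx =>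
    mem_powers_iff_mem_zpowers.mpr (hzp ▸ hx)
  obtain ⟨g, hgJ, hgr⟩ : r ∈ c '' J := hJR ▸ hrR
  obtain ⟨m, hm⟩ := J.2 ⟨g, hgJ⟩
  replace hm : g ^ p ^ m = 1 := by simpa using congrArg Subtype.val hm
  obtain ⟨a, ha⟩ := hmemR (φ g r) (by
    have := Subgroup.characteristic_iff_comap_eq.mp hRchar (φ g)
    exact (SetLike.ext_iff.mp this r).mpr hrR)
  have hak : ∀ k : ℕ, (φ g ^ k) r = r ^ a ^ k := by
    intro k
    induction k with
    | zero => simp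
    | succ k ih => rw [pow_succ, MulAut.mul_apply, ← ha, map_pow, ih, ← pow_mul, pow_succ]
  -- `φ g` has `p`-power order, so `a ^ p ^ m ≡ 1`; modulo `p` the left side is `a` by Fermat.
  have ha1 : a ≡ 1 [MOD p] := by
    have h1 : r ^ a ^ p ^ m = r ^ 1 := by rw [← hak, ← map_pow, hm]; simp
    rw [pow_inj_mod, hr] at h1
    have h2 : a ^ p ^ m ≡ 1 [MOD p] := Nat.ModEq.of_dvd (dvd_pow_self p (by omega)) h1
    rw [← ZMod.natCast_eq_natCast_iff] at h2 ⊢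
    rwa [Nat.cast_pow, ZMod.pow_card_pow] at h2
  have hcg : ∀ k : ℕ, c (g ^ k) = r ^ ∑ i ∈ Finset.range k, a ^ i := by
    intro k
    induction k with
    | zero => simpa using crossedHom_one hc
    | succ k ih =>
      rw [pow_succ', hc, hgr, ih, map_pow, ← ha, geom_sum_succ, ← pow_mul, pow_succ']
  have hcgR : ∀ k : ℕ, c (g ^ k) ∈ R := fun k => hcg k ▸ R.pow_mem hrR _
  -- The values for `k < p ^ n` are distinct by `dvd_of_dvd_geom_sum`, hence fill `R`.
  have hcover : ∀ x ∈ R, ∃ k : ℕ, c (g ^ k) = x := by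
    have hinj : Function.Injective fun k : Fin (p ^ n) => (⟨c (g ^ (k : ℕ)), hcgR k⟩ : R) := by
      have key : ∀ k l : ℕ, k ≤ l → l < p ^ n → c (g ^ k) = c (g ^ l) → k = l := by
        intro k l hkl hl h
        obtain ⟨d, rfl⟩ := Nat.exists_eq_add_of_le hkl
        rw [crossedHom_eq_iff hc, pow_add, inv_mul_cancel_left, hcg, ← orderOf_dvd_iff_pow_eq_one,
          hr] at h
        have := Nat.eq_zero_of_dvd_of_lt (dvd_of_dvd_geom_sum hp hodd ha1 h) (by omega)
        omega
      intro k l h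
      have h1 := congrArg Subtype.val h
      rcases le_total k l with hkl | hkl
      · exact Fin.ext (key k l hkl l.2 h1)
      · exact Fin.ext (key l k hkl k.2 h1.symm).symm
    have hbij := (Nat.bijective_iff_injective_and_card _).mpr ⟨hinj, by simp [hRc]⟩
    intro x hx
    obtain ⟨k, hk⟩ := hbij.2 ⟨x, hx⟩
    exact ⟨k, congrArg Subtype.val hk⟩
  have hcover' : ∀ x ∈ P, ∃ k : ℕ, c' (g ^ k) = x := by
    intro x hx
    obtain ⟨j, hj, rfl⟩ : x ∈ c' '' J := hJP ▸ hx
    obtain ⟨k, hk⟩ := hcover (c j) (by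
      have : c j ∈ c '' J := ⟨j, hj, rfl⟩
      rwa [hJR] at this)
    exact ⟨k, (hcc _ _).mp hk⟩
  have hgP : c' g ∈ P := by
    have : c' g ∈ c' '' J := ⟨g, hgJ, rfl⟩
    rwa [hJP] at this
  let α : MulAut P := ((ψ g).subgroupMap P).trans
    (MulEquiv.subgroupCongr (Subgroup.characteristic_iff_map_eq.mp hPchar (ψ g)))
  have hα : ∀ (k : ℕ) (x : P), ((α ^ k) x : N) = (ψ g ^ k) x := by
    intro k
    induction k with
    | zero => exact fun x => rfl
    | succ k ih =>
      intro x
      rw [pow_succ, pow_succ]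
      exact ih (α x)
  have hcyc : IsCyclic P := by
    refine isCyclic_of_iterate_affine_surjective (m := m) hp hodd hPc α ?_ ⟨c' g, hgP⟩ ?_
    · ext x
      rw [hα, ← map_pow, hm, map_one]
      rfl
    · intro x
      obtain ⟨k, hk⟩ := hcover' x x.2
      refine ⟨k, Subtype.ext ?_⟩
      rw [← hk, crossedHom_pow hc']
      have : Function.Semiconj (Subtype.val : P → N)
          (fun x => ⟨c' g, hgP⟩ * α x) (fun x => c' g * ψ g x) := fun x => rfl
      exact (this.iterate_right k) 1
  obtain ⟨x, hx⟩ := IsCyclic.exists_ofOrder_eq_natCard (α := P)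
  exact ⟨x, by rw [Subgroup.orderOf_coe, hx, hPc]⟩

/-! ### From Hopf Galois structures to crossed homomorphisms -/

/-- Any two embeddings of a field into a normal extension differ by an automorphism. -/
theorem AlgHom.exists_algEquiv_comp_eq {K L E : Type*} [Field K] [Field L] [Field E] [Algebra K L]
    [Algebra K E] [Normal K E] (x y : L →ₐ[K] E) : ∃ g : E ≃ₐ[K] E, (g : E →ₐ[K] E).comp x = y := by
  let χ : x.fieldRange ≃ₐ[K] y.fieldRange :=
    (AlgEquiv.ofInjectiveField x).symm.trans (AlgEquiv.ofInjectiveField y)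
  refine ⟨χ.liftNormal E, AlgHom.ext fun l => ?_⟩
  have h := χ.liftNormal_commutes E (AlgEquiv.ofInjectiveField x l)
  have h2 : χ (AlgEquiv.ofInjectiveField x l) = AlgEquiv.ofInjectiveField y l := by
    exact congrArg (AlgEquiv.ofInjectiveField y)
      ((AlgEquiv.ofInjectiveField x).symm_apply_apply l)
  rw [h2] at h
  exact h

theorem IsNormalClosure.finiteDimensional (K L E : Type*) [Field K] [Field L] [Field E]
    [Algebra K L] [Algebra K E] [FiniteDimensional K L] [IsNormalClosure K L E] :
    FiniteDimensional K E := by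
  have h := (Algebra.IsAlgebraic.isNormalClosure_iff.mp (inferInstance : IsNormalClosure K L E)).2
  have : FiniteDimensional K (IntermediateField.normalClosure K L E) := inferInstance
  rw [h] at this
  exact IntermediateField.topEquiv.toLinearEquiv.finiteDimensional

namespace HopfGaloisStructure

variable {K : Type u} {L : Type v} [Field K] [Field L] [Algebra K L]
  (S : HopfGaloisStructure.{u, v, w} K L) {E : Type*} [Field E] [Algebra K E]

/-- The action of `E ⊗ H` on embeddings: `e ⊗ h` sends `x : L → E` to `l ↦ e * x (h · l)`. -/
noncomputable def act (x : L →ₐ[K] E) : E ⊗[K] S.H →ₗ[E] (L →ₗ[K] E) :=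
  LinearMap.liftBaseChange E ((LinearMap.llcomp K L L E x.toLinearMap).comp S.μ.toLinearMap)

@[simp]
theorem act_tmul (x : L →ₐ[K] E) (e : E) (h : S.H) (l : L) :
    S.act x (e ⊗ₜ h) l = e * x (S.μ h l) := by
  simp [act]

/-- The action on embeddings is a right action: the left factor `η` acts first. -/
theorem act_mul {x y : L →ₐ[K] E} {η : E ⊗[K] S.H} (hy : y.toLinearMap = S.act x η)
    (η' : E ⊗[K] S.H) : S.act x (η * η') = S.act y η' := by
  have hy' : ∀ l, y l = S.act x η l := fun l => DFunLike.congr_fun hy l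
  ext l
  induction η' using TensorProduct.induction_on with
  | zero => simp
  | add a b ha hb => rw [mul_add, map_add, map_add, LinearMap.add_apply, LinearMap.add_apply, ha, hb]
  | tmul e' h' =>
    rw [act_tmul, hy']
    clear hy hy'
    induction η using TensorProduct.induction_on with
    | zero => simp
    | add a b ha hb =>
      rw [add_mul, map_add, map_add, LinearMap.add_apply, LinearMap.add_apply, ha, hb, mul_add]
    | tmul e h => simp [mul_left_comm, mul_assoc]

theorem comp_act (g : E →ₐ[K] E) (x : L →ₐ[K] E) (η : E ⊗[K] S.H) :
    g.toLinearMap ∘ₗ S.act x η =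
      S.act (g.comp x) (Algebra.TensorProduct.map g (AlgHom.id K S.H) η) := by
  ext l
  induction η using TensorProduct.induction_on with
  | zero => simp
  | add a b ha hb =>
    simp only [map_add, LinearMap.comp_add, LinearMap.add_apply, ha, hb]
  | tmul e h => simp

theorem act_apply_one (x : L →ₐ[K] E) (η : E ⊗[K] S.H) :
    S.act x η 1 = Coalgebra.counit (R := E) η := by
  induction η using TensorProduct.induction_on with
  | zero => simp
  | add a b ha hb => simp only [map_add, LinearMap.add_apply, ha, hb]
  | tmul e h => simp [S.map_one', Algebra.smul_def, mul_comm]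

theorem act_apply_mul (x : L →ₐ[K] E) (η : E ⊗[K] S.H) (l l' : L) :
    S.act x η (l * l') = LinearMap.mul' E E
      (TensorProduct.map ((S.act x).flip l) ((S.act x).flip l') (Coalgebra.comul (R := E) η)) := by
  induction η using TensorProduct.induction_on with
  | zero => simp
  | add a b ha hb => simp only [map_add, LinearMap.add_apply, ha, hb]
  | tmul e h =>
    rw [act_tmul, S.map_mul', TensorProduct.comul_tmul, CommSemiring.comul_apply]
    induction (Coalgebra.comul (R := K) h) using TensorProduct.induction_on with
    | zero => simp
    | add a b ha hb => simp only [map_add, TensorProduct.tmul_add, mul_add, ha, hb]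
    | tmul a b => simp [mul_left_comm]

/-- By bijectivity of `L ⊗ H → End_K(L)`, the range contains every `x ∘ T`, and these span `Hom_K(L,
E)` over `E`. -/
theorem act_surjective [FiniteDimensional K L] (x : L →ₐ[K] E) :
    Function.Surjective (S.act x) := by
  have h1 : ∀ T : Module.End K L, x.toLinearMap ∘ₗ T ∈ LinearMap.range (S.act x) := by
    intro T
    obtain ⟨t, rfl⟩ := S.bijective'.2 T
    refine ⟨Algebra.TensorProduct.map x (AlgHom.id K S.H) t, ?_⟩
    ext l
    induction t using TensorProduct.induction_on with
    | zero => simp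
    | add a b ha hb => simp only [map_add, LinearMap.comp_add, LinearMap.add_apply, ha, hb]
    | tmul e h => simp
  rw [← LinearMap.range_eq_top, eq_top_iff]
  rintro f -
  let b := Module.finBasis K L
  have hf : f = ∑ i, f (b i) • (x.toLinearMap ∘ₗ (b.coord i).smulRight (1 : L)) := by
    refine b.ext fun j => ?_
    simp [LinearMap.sum_apply, Finsupp.single_apply]
  rw [hf]
  exact Submodule.sum_mem _ fun i _ => Submodule.smul_mem _ _ (h1 _)

theorem finrank_eq [FiniteDimensional K L] : Module.finrank K S.H = Module.finrank K L := by
  have h := (LinearEquiv.ofBijective _ S.bijective').finrank_eq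
  rw [Module.finrank_tensorProduct, Module.finrank_linearMap] at h
  exact Nat.eq_of_mul_eq_mul_left Module.finrank_pos h

theorem act_injective [FiniteDimensional K L] (x : L →ₐ[K] E) : Function.Injective (S.act x) := by
  refine (LinearMap.injective_iff_surjective_of_finrank_eq_finrank ?_).mpr (S.act_surjective x)
  rw [Module.finrank_baseChange, Module.finrank_linearMap, Module.finrank_self, mul_one,
    S.finrank_eq]

/-- A Hopf Galois structure of type `N` makes `N` act simply transitively on the embeddings of `L`
into `E`, compatibly with the action of the Galois group `G` of `E`. Comparing both actions at an
embedding `x₀` gives a surjective crossed homomorphism `G → N`. -/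
theorem IsOfType.exists_crossedHom [FiniteDimensional K L] [Algebra.IsSeparable K L]
    [IsNormalClosure K L E] {N : Type*} [Group N] {S : HopfGaloisStructure.{u, v, w} K L}
    (hS : S.IsOfType E N) (x₀ : L →ₐ[K] E) :
    ∃ (φ : (E ≃ₐ[K] E) →* MulAut N) (c : (E ≃ₐ[K] E) → N), Function.Surjective c ∧
      (∀ g h, c (g * h) = c g * φ g (c h)) ∧
      ∀ g h, c g = c h ↔ (g : E →ₐ[K] E).comp x₀ = (h : E →ₐ[K] E).comp x₀ := by
  obtain ⟨e⟩ := hS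
  have : Normal K E := IsNormalClosure.normal (K := L)
  let u : N → E ⊗[K] S.H := fun n => e.symm (MonoidAlgebra.of E N n)
  have hu_mul : ∀ n m, u (n * m) = u n * u m := fun n m => by
    simp only [u, map_mul]
  have hu_one : u 1 = 1 := by simp only [u, map_one]
  have hu_inj : Function.Injective u := e.symm.injective.comp MonoidAlgebra.of_injective
  have hu_gl : ∀ n, IsGroupLikeElem E (u n) := fun n =>
    (MonoidAlgebra.isGroupLikeElem_of n).map e.symm
  let a : (L →ₐ[K] E) → N → (L →ₐ[K] E) := fun x n =>
    AlgHom.ofLinearMap (S.act x (u n))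
      (by rw [S.act_apply_one, (hu_gl n).counit_eq_one])
      (fun l l' => by rw [S.act_apply_mul, (hu_gl n).comul_eq_tmul_self]; rfl)
  have ha : ∀ x n, (a x n).toLinearMap = S.act x (u n) := fun x n => rfl
  have ha_inj : ∀ x, Function.Injective (a x) := fun x n m h =>
    hu_inj (S.act_injective x (by rw [← ha, ← ha, h]))
  -- Both equal `[L : K]`: one as the `E`-dimension of `E ⊗ H`, the other by separability.
  have hcard : Nat.card N = Nat.card (L →ₐ[K] E) := by
    let b : Module.Basis N E (E ⊗[K] S.H) :=
      .ofRepr ((e : E ⊗[K] S.H ≃ₗ[E] _).trans (MonoidAlgebra.coeffLinearEquiv E))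
    rw [AlgHom.natCard_of_splits K L E IsNormalClosure.splits, ← S.finrank_eq,
      ← Module.finrank_baseChange (R := E), Module.finrank_eq_nat_card_basis b]
  have : Finite (L →ₐ[K] E) := inferInstance
  have ha_bij : ∀ x, Function.Bijective (a x) := fun x =>
    have : Finite N := Finite.of_injective _ (ha_inj x)
    (Nat.bijective_iff_injective_and_card _).mpr ⟨ha_inj x, hcard⟩
  let τ : (E ≃ₐ[K] E) → E ⊗[K] S.H →ₐ[K] E ⊗[K] S.H := fun g =>
    Algebra.TensorProduct.map (g : E →ₐ[K] E) (AlgHom.id K S.H)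
  have hτ : ∀ (g : E ≃ₐ[K] E) x η,
      (g : E →ₐ[K] E).toLinearMap ∘ₗ S.act x η = S.act ((g : E →ₐ[K] E).comp x) (τ g η) :=
    fun g x η => S.comp_act g x η
  have hτ_one : ∀ η, τ 1 η = η := fun η => by
    induction η using TensorProduct.induction_on with
    | zero => simp
    | add a b ha hb => rw [map_add, ha, hb]
    | tmul e h => simp [τ]
  have hτ_mul : ∀ g h η, τ (g * h) η = τ g (τ h η) := fun g h η => by
    induction η using TensorProduct.induction_on with
    | zero => simp
    | add a b ha hb => simp only [map_add, ha, hb]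
    | tmul e h => simp [τ]
  -- Galois preserves the group-likes: `m` is the element carrying `g ∘ x₀` to `g ∘ (x₀ · n)`, and
  -- injectivity of the action identifies `u m`.
  have hex : ∀ g n, ∃ m, u m = τ g (u n) := fun g n => by
    obtain ⟨m, hm⟩ := (ha_bij ((g : E →ₐ[K] E).comp x₀)).2 ((g : E →ₐ[K] E).comp (a x₀ n))
    refine ⟨m, S.act_injective ((g : E →ₐ[K] E).comp x₀) ?_⟩
    rw [← hτ, ← ha, ← ha, hm]
    rfl
  choose f hf using hex
  let _ : MulDistribMulAction (E ≃ₐ[K] E) N :=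
    { smul := f
      one_smul := fun n => hu_inj (by
        change u (f 1 n) = u n
        rw [hf, hτ_one])
      mul_smul := fun g h n => hu_inj (by
        change u (f (g * h) n) = u (f g (f h n))
        rw [hf, hf, hf, hτ_mul])
      smul_mul := fun g n m => hu_inj (by
        change u (f g (n * m)) = u (f g n * f g m)
        rw [hu_mul, hf, hf, hf, hu_mul, map_mul])
      smul_one := fun g => hu_inj (by
        change u (f g 1) = u 1
        rw [hf, hu_one, map_one]) }
  choose c hc using fun g : E ≃ₐ[K] E => (ha_bij x₀).2 ((g : E →ₐ[K] E).comp x₀)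
  refine ⟨MulDistribMulAction.toMulAut _ _, c, fun n => ?_, fun g h => ha_inj x₀ ?_, fun g h => ?_⟩
  · obtain ⟨g, hg⟩ := AlgHom.exists_algEquiv_comp_eq x₀ (a x₀ n)
    exact ⟨g, ha_inj x₀ (by rw [hc, hg])⟩
  · change _ = a x₀ (c g * f g (c h))
    apply AlgHom.toLinearMap_injective
    rw [ha x₀ (_ * _), hu_mul, S.act_mul (ha x₀ (c g)), hc, hf, hc, ← hτ, ← ha, hc]
    rfl
  · rw [← hc, ← hc]
    exact (ha_inj x₀).eq_iff.symm

end HopfGaloisStructure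

/-! ### Exponents and conclusion -/

theorem exponent_eq_of_exists_orderOf {N : Type*} [Group N] {p n : ℕ} (hp : p.Prime)
    (hp2 : p ≠ 2) (hN : Nat.card N = 2 * p ^ n) {x : N} (hx : orderOf x = p ^ n) :
    Monoid.exponent N = 2 * p ^ n := by
  have : Finite N := Nat.finite_of_card_ne_zero (by have := pow_pos hp.pos n; omega)
  have : Fact (Nat.Prime 2) := ⟨Nat.prime_two⟩
  obtain ⟨y, hy⟩ := exists_prime_orderOf_dvd_card' (G := N) 2 (hN ▸ dvd_mul_right _ _)
  refine Nat.dvd_antisymm (hN ▸ Group.exponent_dvd_nat_card) ?_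
  refine Nat.Coprime.mul_dvd_of_dvd_of_dvd ?_ (hy ▸ Monoid.order_dvd_exponent y)
    (hx ▸ Monoid.order_dvd_exponent x)
  exact ((Nat.coprime_primes Nat.prime_two hp).mpr hp2.symm).pow_right n

theorem mainTheorem2
    {K : Type*} {L : Type*} [Field K] [Field L] [Algebra K L] [Algebra.IsSeparable K L]
    (E : Type*) [Field E] [Algebra K E] [IsNormalClosure K L E]
    (p n : ℕ) (hp : p.Prime) (hp2 : p ≠ 2) (hn : 1 ≤ n)
    (hdeg : Module.finrank K L = 2 * p ^ n)
    (hD : ∃ S : HopfGaloisStructure.{_, _, w₁} K L, S.IsOfType E (DihedralGroup (p ^ n)))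
    (N : Type*) [Group N] (hN : Nat.card N = 2 * p ^ n)
    (hexp : Monoid.exponent N < 2 * p ^ n) :
    ¬ ∃ T : HopfGaloisStructure.{_, _, w₂} K L, T.IsOfType E N := by
  rintro ⟨T, hT⟩
  obtain ⟨S, hS⟩ := hD
  have hpn : 0 < p ^ n := pow_pos hp.pos n
  have hodd : Odd p := hp.odd_of_ne_two hp2
  have : FiniteDimensional K L := Module.finite_of_finrank_pos (by omega)
  have : FiniteDimensional K E := IsNormalClosure.finiteDimensional K L E
  have hX : Nat.card (L →ₐ[K] E) ≠ 0 := by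
    rw [AlgHom.natCard_of_splits K L E IsNormalClosure.splits]
    omega
  obtain ⟨x₀⟩ : Nonempty (L →ₐ[K] E) := (Nat.card_ne_zero.mp hX).1
  obtain ⟨φ, c, hsurj, hc, hcx⟩ := hS.exists_crossedHom x₀
  obtain ⟨ψ, c', hsurj', hc', hcx'⟩ := hT.exists_crossedHom x₀
  obtain ⟨x, hx⟩ := exists_orderOf_eq_of_crossedHom hp hodd hn DihedralGroup.nat_card hN hc hsurj
    hc' hsurj' (fun g h => (hcx g h).trans (hcx' g h).symm) (r := DihedralGroup.r 1)
    DihedralGroup.orderOf_r_one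
  exact hexp.ne (exponent_eq_of_exists_orderOf hp hp2 hN hx)
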